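/- Let $n_1,n_2,s,\tilde m\ge 1$ be integers and $n=n_1+n_2-1$; all indices start at $0$. For $0\le a\le n-1$ let $w_a$ be the number of pairs $(j,k)$ with $0\le j\le n_1-1$, $0\le k\le n_2-1$, $j+k=a$. Equip $\mathbb C^{n_1\times n_2\times s}$ and $\mathbb C^{s\times n}$ with the Frobenius norm $\|\cdot\|_F$ and its inner product, and write $\|\cdot\|$ for the induced operator norm. Let $\mathcal G=\mathcal H\mathcal D^{-1}:\mathbb C^{s\times n}\to\mathbb C^{n_1\times n_2\times s}$, where $[\mathcal H(X)](i_1,i_2,i_3)=X(i_3,i_1+i_2)$ and $[\mathcal D(X)](j,a)=\sqrt{w_a}\,X(j,a)$, and let $\mathcal G^*$ be its adjoint. For $0\le k\le n-1$ and $0\le j\le s-1$ let $\mathcal H_{k,j}\in\mathbb C^{n_1\times n_2\times s}$ be the Hankel tensor basis element, whose $(i_1,i_2,i_3)$ entry is $w_k^{-1/2}$ if $i_1+i_2=k$ and $i_3=j$, and $0$ otherwise. Let $a_1,\dots,a_{\tilde m}$ be drawn independently and uniformly (with replacement) from $\{0,\dots,s-1\}\times\{0,\dots,n-1\}$, let $\tilde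 p=\tilde m/(sn)$, and let $\mathcal P_{\tilde\Omega}(X)=\sum_{i=1}^{\tilde m}X(a_i)E_{a_i}$, where $E_x$ is the matrix whose only non-zero entry is a $1$ at position $x$ (repeated indices are counted with multiplicity). **Lemma.** There are universal constants $C_1,C_2>0$ such that the following holds for all such $n_1,n_2,s,\tilde m$. Let $\mathcal P_{T_1},\mathcal P_{T_2}$ be (possibly random) self-adjoint projection operators on $\mathbb C^{n_1\times n_2\times s}$ such that the pair $(\mathcal P_{T_1},\mathcal P_{T_2})$ is independent of the sample $(a_1,\dots,a_{\tilde m})$, and let $q_i=\max_{k,j}\|\mathcal P_{T_i}\mathcal H_{k,j}\|_F$ for $i=1,2$. If, almost surely, $$\tilde m\ \ge\ C_1\max\{q_1^2,q_2^2\}\,sn\log(sn),$$ then with probability at least $1-(sn)^{-2}$, $$\big\|\mathcal P_{T_2}\,\mathcal G\,(\tilde p^{-1}\mathcal P_{\tilde\Omega}-\mathcal I)\,\mathcal G^*\,\mathcal P_{T_1}\big\|\ \le\ C_2\sqrt{\frac{\max\{q_1^2,q_2^2\}\,sn\log(sn)}{\tilde m}}.$$ -/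

import Mathlib

open MeasureTheory ProbabilityTheory

noncomputable section

/-- The signal length `n = n₁ + n₂ - 1` (used for `n₁, n₂ ≥ 1` only). -/
abbrev sigLen (n₁ n₂ : ℕ) : ℕ := n₁ + n₂ - 1

/-- Tensors in `ℂ^{n₁ × n₂ × s}`; the norm is the Frobenius norm, and the norm of a continuous
linear map between such spaces is the induced operator norm. -/
abbrev Tensor3 (n₁ n₂ s : ℕ) : Type := EuclideanSpace ℂ (Fin n₁ × Fin n₂ × Fin s)

/-- Matrices in `ℂ^{s × n}`, with the Frobenius norm. -/
abbrev SigMat (s n : ℕ) : Type := EuclideanSpace ℂ (Fin s × Fin n)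

/-- `w_a`, the number of `(j, k)` with `j + k = a`, `0 ≤ j ≤ n₁ - 1`, `0 ≤ k ≤ n₂ - 1`. -/
def diagLen (n₁ n₂ a : ℕ) : ℕ :=
  (Finset.univ.filter fun p : Fin n₁ × Fin n₂ => (p.1 : ℕ) + (p.2 : ℕ) = a).card

/-- The `k`-th Hankel matrix basis element `H_k(i₁, i₂) = e_k(i₁ + i₂) / √w_k`. -/
def hankelMatrixBasis (n₁ n₂ : ℕ) (k : Fin (sigLen n₁ n₂)) : Matrix (Fin n₁) (Fin n₂) ℝ :=
  Matrix.of fun i₁ i₂ =>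
    (1 / √(diagLen n₁ n₂ k : ℝ)) * (if (i₁ : ℕ) + (i₂ : ℕ) = (k : ℕ) then 1 else 0)

/-- The `(k, j)`-th Hankel tensor basis element, with entries `H_k(i₁, i₂) e_j(i₃)`. -/
def hankelTensorBasis (n₁ n₂ s : ℕ) (k : Fin (sigLen n₁ n₂)) (j : Fin s) : Tensor3 n₁ n₂ s :=
  WithLp.toLp 2 fun i =>
    ((hankelMatrixBasis n₁ n₂ k i.1 i.2.1 * (if i.2.2 = j then 1 else 0) : ℝ) : ℂ)

/-- The Hankel tensor lifting operator `[𝓗 X](i₁, i₂, i₃) = X(i₃, i₁ + i₂)`. -/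
def hankelLift (n₁ n₂ s : ℕ) : SigMat s (sigLen n₁ n₂) →L[ℂ] Tensor3 n₁ n₂ s :=
  LinearMap.toContinuousLinearMap
    { toFun := fun X => WithLp.toLp 2 fun i =>
        X (i.2.2, ⟨(i.1 : ℕ) + (i.2.1 : ℕ), by
          have h₁ := i.1.isLt
          have h₂ := i.2.1.isLt
          simp only [sigLen]
          omega⟩)
      map_add' := fun X Y => by ext i; simp
      map_smul' := fun c X => by ext i; simp }

/-- The reweighting operator `[𝓓 M](:, a) = √w_a M(:, a)`. -/
def reweight (n₁ n₂ s : ℕ) : SigMat s (sigLen n₁ n₂) →L[ℂ] SigMat s (sigLen n₁ n₂) :=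
  LinearMap.toContinuousLinearMap
    { toFun := fun X => WithLp.toLp 2 fun i => ((√(diagLen n₁ n₂ i.2 : ℝ) : ℝ) : ℂ) * X i
      map_add' := fun X Y => by ext i; simp [mul_add]
      map_smul' := fun c X => by ext i; simp [mul_left_comm] }

/-- The operator `[𝓓⁻¹ M](:, a) = M(:, a) / √w_a`. -/
def reweightInv (n₁ n₂ s : ℕ) : SigMat s (sigLen n₁ n₂) →L[ℂ] SigMat s (sigLen n₁ n₂) :=
  LinearMap.toContinuousLinearMap
    { toFun := fun X => WithLp.toLp 2 fun i => ((√(diagLen n₁ n₂ i.2 : ℝ) : ℝ) : ℂ)⁻¹ * X i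
      map_add' := fun X Y => by ext i; simp [mul_add]
      map_smul' := fun c X => by ext i; simp [mul_left_comm] }

theorem diagLen_pos {n₁ n₂ : ℕ} (h₁ : 0 < n₁) (h₂ : 0 < n₂) (a : Fin (sigLen n₁ n₂)) :
    0 < diagLen n₁ n₂ a := by
  have ha : (a : ℕ) < n₁ + n₂ - 1 := a.isLt
  refine Finset.card_pos.mpr
    ⟨(⟨min (a : ℕ) (n₁ - 1), by omega⟩, ⟨(a : ℕ) - min (a : ℕ) (n₁ - 1), by omega⟩), ?_⟩
  simp

theorem reweight_comp_reweightInv {n₁ n₂ : ℕ} (s : ℕ) (h₁ : 0 < n₁) (h₂ : 0 < n₂) :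
    reweight n₁ n₂ s ∘L reweightInv n₁ n₂ s = ContinuousLinearMap.id ℂ _ := by
  ext X i
  have h : ((√(diagLen n₁ n₂ i.2 : ℝ) : ℝ) : ℂ) ≠ 0 := by
    have := diagLen_pos h₁ h₂ i.2
    exact_mod_cast (Real.sqrt_pos.mpr (by exact_mod_cast this)).ne'
  simp [reweight, reweightInv, h]

/-- The operator `𝓖 = 𝓗 𝓓⁻¹ : ℂ^{s × n} → ℂ^{n₁ × n₂ × s}`. -/
def hankelG (n₁ n₂ s : ℕ) : SigMat s (sigLen n₁ n₂) →L[ℂ] Tensor3 n₁ n₂ s :=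
  hankelLift n₁ n₂ s ∘L reweightInv n₁ n₂ s

/-- The operator `X ↦ X(x) E_x` that keeps only the entry of `X` at the index `x`. -/
def entryProj {s n : ℕ} (x : Fin s × Fin n) : SigMat s n →L[ℂ] SigMat s n :=
  (EuclideanSpace.proj x : SigMat s n →L[ℂ] ℂ).smulRight (EuclideanSpace.single x (1 : ℂ))

/-- The sampling operator `𝓟_Ω = ∑ i, 𝓟_{a_i}` of the sample `a_1, …, a_m` of indices drawn with
replacement: an index that is drawn several times is counted with its multiplicity. -/
def samplingOp {s n m : ℕ} (a : Fin m → Fin s × Fin n) : SigMat s n →L[ℂ] SigMat s n :=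
  ∑ i, entryProj (a i)

/-- `q(P) = max_{k,j} ‖P 𝓗_{k,j}‖_F`. -/
def basisMax {n₁ n₂ s : ℕ} (P : Tensor3 n₁ n₂ s →L[ℂ] Tensor3 n₁ n₂ s) : ℝ :=
  ⨆ kj : Fin (sigLen n₁ n₂) × Fin s, ‖P (hankelTensorBasis n₁ n₂ s kj.1 kj.2)‖

/-- The operator `P₂ 𝓖 (p⁻¹ 𝓟_Ω - 𝓘) 𝓖^* P₁` with `p = m / (s n)`. -/
def samplingDeviation {n₁ n₂ s m : ℕ} (P₁ P₂ : Tensor3 n₁ n₂ s →L[ℂ] Tensor3 n₁ n₂ s)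
    (a : Fin m → Fin s × Fin (sigLen n₁ n₂)) : Tensor3 n₁ n₂ s →L[ℂ] Tensor3 n₁ n₂ s :=
  P₂ ∘L hankelG n₁ n₂ s ∘L
    ((((m : ℂ) / ((s : ℂ) * (sigLen n₁ n₂ : ℂ)))⁻¹ • samplingOp a) -
      ContinuousLinearMap.id ℂ (SigMat s (sigLen n₁ n₂))) ∘L
    ContinuousLinearMap.adjoint (hankelG n₁ n₂ s) ∘L P₁

end

/-! For fixed projections the lemma is a counting statement about samples. The `h_p = 𝓖 E_p` form an
orthonormal family indexed by the `N = sn` entries, and the operator is `(N/m) ∑ i, ⟪P₁ h_{a_i}, ·⟫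
P₂ h_{a_i}` minus its mean (`samplingDeviation_eq`). Polarization bounds it by four self-adjoint
sums of the same kind, built from `w_a = P₂ h_a + I^k P₁ h_a`, with `‖w_a‖² ≤ K = 4 max(q₁², q₂²)`
and `∑ a, |⟪w_a, z⟫|² ≤ B ‖z‖²`, `B = 4`.

Let `X` be such a sum and `F(κ) = ∑ x, tr e^{κX(x)}`. The method of exchangeable pairs resamples one
coordinate at a time and bounds `κF'(κ)` by a trace of `e^{κX}` against a variance
(`exchangeable_pairs_bound`). The only trace inequality needed, `mean_value_trace_exp`, follows from
a scalar one by expanding in two eigenbases. The variance is self-bounding: at an eigenvector of `X`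
it is controlled by the eigenvalue itself plus `2B`. Hence `κF' ≤ κ²c(F' + 2BF)` with `c = NK/m`,
which integrates to `F(κ) ≤ F(0) e^{2Bcκ²}` for `|κ|c ≤ 1/2`, and a Laplace bound gives the tail.

Finally, `measureReal_bad_le_of_indepFun` passes from fixed projections to random ones independent
of the sample. -/

open scoped InnerProductSpace

/-! ### The mean value trace inequality for the exponential -/

section TraceInequality

variable {V : Type*} [NormedAddCommGroup V] [InnerProductSpace ℂ V]
  {ι : Type*} [Fintype ι]

/-- Hermite–Hadamard upper bound for the exponential, in symmetric form. -/
theorem sub_mul_exp_sub_exp_le (a b : ℝ) :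
    (a - b) * (Real.exp a - Real.exp b) ≤ (a - b) ^ 2 * (Real.exp a + Real.exp b) / 2 := by
  -- This is the trapezoid bound for `exp` on `[0, z]`. The general case follows by symmetry in `a`,
  -- `b` and scaling by `e^b`.
  have key : ∀ z : ℝ, 0 ≤ z → Real.exp z - 1 ≤ z * (Real.exp z + 1) / 2 := by
    intro z hz
    have hd : ∀ y : ℝ, HasDerivAt (fun y => y * (Real.exp y + 1) / 2 - (Real.exp y - 1))
        ((1 * (Real.exp y + 1) + y * Real.exp y) / 2 - Real.exp y) y := fun y =>
      (((hasDerivAt_id y).mul ((Real.hasDerivAt_exp y).add_const 1)).div_const 2).sub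
        ((Real.hasDerivAt_exp y).sub_const 1)
    have hmono : Monotone (fun y : ℝ => y * (Real.exp y + 1) / 2 - (Real.exp y - 1)) := by
      refine monotone_of_deriv_nonneg (fun y => (hd y).differentiableAt) fun y => ?_
      rw [(hd y).deriv]
      have h1 : 1 - y ≤ Real.exp (-y) := by linarith [Real.add_one_le_exp (-y)]
      have h2 : (1 - y) * Real.exp y ≤ Real.exp (-y) * Real.exp y :=
        mul_le_mul_of_nonneg_right h1 (Real.exp_pos y).le
      rw [← Real.exp_add, neg_add_cancel, Real.exp_zero] at h2
      linarith
    have := hmono hz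
    simp only [Real.exp_zero] at this
    linarith
  wlog h : b ≤ a generalizing a b
  · have := this b a (le_of_not_ge h)
    linarith
  have h1 := key (a - b) (sub_nonneg.2 h)
  have h2 : Real.exp a = Real.exp (a - b) * Real.exp b := by rw [← Real.exp_add]; simp
  rw [h2]
  have h3 := mul_le_mul_of_nonneg_left h1 (mul_nonneg (sub_nonneg.2 h) (Real.exp_pos b).le)
  linarith

/-- In mixed coordinates `⟪v j, (S - T) u i⟫ = (α i - β j) ⟪v j, u i⟫`, so traces against `S - T`
become double sums with the nonnegative weights `|⟪v j, u i⟫|²`, although `S` and `T` need not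
commute. -/
theorem OrthonormalBasis.re_inner_sub_apply_eq_sum (u v : OrthonormalBasis ι ℂ V)
    {α β : ι → ℝ} {S T : V →L[ℂ] V} (hS : ∀ i, S (u i) = (α i : ℂ) • u i)
    (hT : ∀ j, T (v j) = (β j : ℂ) • v j) (hTs : ∀ x y, ⟪T x, y⟫_ℂ = ⟪x, T y⟫_ℂ) (i : ι) :
    (⟪u i, (S - T) (u i)⟫_ℂ).re = ∑ j, (α i - β j) * ‖⟪v j, u i⟫_ℂ‖ ^ 2 := by
  rw [← v.sum_inner_mul_inner, Complex.re_sum]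
  refine Finset.sum_congr rfl fun j _ => ?_
  have : ⟪v j, (S - T) (u i)⟫_ℂ = ((α i - β j : ℝ) : ℂ) * ⟪v j, u i⟫_ℂ := by
    rw [sub_apply, inner_sub_right, ← hTs, hS, hT, inner_smul_left,
      inner_smul_right]
    simp [sub_mul]
  rw [this, mul_left_comm, Complex.re_ofReal_mul, ← inner_conj_symm (u i), mul_comm (starRingEnd ℂ _),
    Complex.mul_conj, Complex.ofReal_re, Complex.normSq_eq_norm_sq]

theorem OrthonormalBasis.norm_sub_apply_sq_eq_sum (u v : OrthonormalBasis ι ℂ V)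
    {α β : ι → ℝ} {S T : V →L[ℂ] V} (hS : ∀ i, S (u i) = (α i : ℂ) • u i)
    (hT : ∀ j, T (v j) = (β j : ℂ) • v j) (hTs : ∀ x y, ⟪T x, y⟫_ℂ = ⟪x, T y⟫_ℂ) (i : ι) :
    ‖(S - T) (u i)‖ ^ 2 = ∑ j, (α i - β j) ^ 2 * ‖⟪v j, u i⟫_ℂ‖ ^ 2 := by
  rw [← v.sum_sq_norm_inner_right]
  refine Finset.sum_congr rfl fun j _ => ?_
  have : ⟪v j, (S - T) (u i)⟫_ℂ = ((α i - β j : ℝ) : ℂ) * ⟪v j, u i⟫_ℂ := by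
    rw [sub_apply, inner_sub_right, ← hTs, hS, hT, inner_smul_left,
      inner_smul_right]
    simp [sub_mul]
  rw [this, norm_mul, mul_pow, Complex.norm_real, Real.norm_eq_abs, sq_abs]

/-- The mean value trace inequality
`κ tr((S - T)(e^{κS} - e^{κT})) ≤ (κ²/2) tr((S - T)²(e^{κS} + e^{κT}))`,
written in eigenbases of `S` and `T`. -/
theorem mean_value_trace_exp (u v : OrthonormalBasis ι ℂ V)
    {α β : ι → ℝ} {S T : V →L[ℂ] V} (hS : ∀ i, S (u i) = (α i : ℂ) • u i)
    (hT : ∀ j, T (v j) = (β j : ℂ) • v j) (hSs : ∀ x y, ⟪S x, y⟫_ℂ = ⟪x, S y⟫_ℂ)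
    (hTs : ∀ x y, ⟪T x, y⟫_ℂ = ⟪x, T y⟫_ℂ) (κ : ℝ) :
    κ * (∑ i, Real.exp (κ * α i) * (⟪u i, (S - T) (u i)⟫_ℂ).re -
        ∑ j, Real.exp (κ * β j) * (⟪v j, (S - T) (v j)⟫_ℂ).re) ≤
      κ ^ 2 / 2 * (∑ i, Real.exp (κ * α i) * ‖(S - T) (u i)‖ ^ 2 +
        ∑ j, Real.exp (κ * β j) * ‖(S - T) (v j)‖ ^ 2) := by
  have e1 : ∀ j, (⟪v j, (S - T) (v j)⟫_ℂ).re =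
      ∑ i, (α i - β j) * ‖⟪v j, u i⟫_ℂ‖ ^ 2 := by
    intro j
    rw [← neg_sub T S, neg_apply, inner_neg_right, Complex.neg_re,
      v.re_inner_sub_apply_eq_sum u hT hS hSs, ← Finset.sum_neg_distrib]
    refine Finset.sum_congr rfl fun i _ => ?_
    rw [norm_inner_symm]; ring
  have e2 : ∀ j, ‖(S - T) (v j)‖ ^ 2 = ∑ i, (α i - β j) ^ 2 * ‖⟪v j, u i⟫_ℂ‖ ^ 2 := by
    intro j
    rw [← neg_sub T S, neg_apply, norm_neg,
      v.norm_sub_apply_sq_eq_sum u hT hS hSs]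
    refine Finset.sum_congr rfl fun i _ => ?_
    rw [norm_inner_symm]; ring
  simp only [u.re_inner_sub_apply_eq_sum v hS hT hTs, u.norm_sub_apply_sq_eq_sum v hS hT hTs,
    e1, e2, Finset.mul_sum]
  rw [Finset.sum_comm (f := fun j i => Real.exp (κ * β j) * _),
    Finset.sum_comm (f := fun j i => Real.exp (κ * β j) * _),
    ← Finset.sum_sub_distrib, ← Finset.sum_add_distrib, Finset.mul_sum, Finset.mul_sum]
  refine Finset.sum_le_sum fun i _ => ?_
  rw [← Finset.sum_sub_distrib, ← Finset.sum_add_distrib, Finset.mul_sum, Finset.mul_sum]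
  refine Finset.sum_le_sum fun j _ => ?_
  -- Both sides are now double sums with the same weights, so the scalar inequality applies term by
  -- term.
  have := mul_le_mul_of_nonneg_right (sub_mul_exp_sub_exp_le (κ * α i) (κ * β j))
    (sq_nonneg ‖⟪v j, u i⟫_ℂ‖)
  linarith

end TraceInequality

/-! ### Exchangeable pairs -/

section Exchange

/-- Exchanging one coordinate of a sample with an independent copy. -/
theorem sum_sum_update_swap {A J : Type*} [Fintype A] [Fintype J] [DecidableEq J]
    (i : J) (F : (J → A) → A → ℝ) :
    ∑ x : J → A, ∑ b, F (Function.update x i b) (x i) = ∑ x : J → A, ∑ b, F x b := by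
  have hinv : Function.Involutive
      (fun p : (J → A) × A => (Function.update p.1 i p.2, p.1 i)) := fun p => by simp
  rw [← Fintype.sum_prod_type', ← Fintype.sum_prod_type']
  exact Equiv.sum_comp hinv.toPerm (fun p => F p.1 p.2)

variable {V : Type*} [NormedAddCommGroup V] [InnerProductSpace ℂ V]
  {ι : Type*} [Fintype ι] {A : Type*} [Fintype A] {m : ℕ}

/-- The bound on the derivative of the trace moment generating function of a sum of independent
centred operators, by the method of exchangeable pairs. -/
theorem exchangeable_pairs_bound {Y : A → V →L[ℂ] V}
    (hYs : ∀ a x y, ⟪Y a x, y⟫_ℂ = ⟪x, Y a y⟫_ℂ) (hY0 : ∑ a, Y a = 0)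
    (u : (Fin m → A) → OrthonormalBasis ι ℂ V) (α : (Fin m → A) → ι → ℝ)
    (hu : ∀ x l, (∑ i, Y (x i)) (u x l) = (α x l : ℂ) • u x l) (κ : ℝ) :
    (Fintype.card A : ℝ) * (κ * ∑ x, ∑ l, α x l * Real.exp (κ * α x l)) ≤
      κ ^ 2 / 2 * ∑ x, ∑ l, Real.exp (κ * α x l) *
        ∑ i, ∑ b, ‖(Y (x i) - Y b) (u x l)‖ ^ 2 := by
  -- With `X` the sum at `x`, `τ x Z` is `Re tr(e^{κX} Z)`; below, `σ x Z` is `tr(e^{κX} Z²)` for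
  -- self-adjoint `Z`.
  set τ : (Fin m → A) → (V →L[ℂ] V) → ℝ := fun x Z =>
    ∑ l, Real.exp (κ * α x l) * (⟪u x l, Z (u x l)⟫_ℂ).re with hτ
  have τsub : ∀ x Z W, τ x (Z - W) = τ x Z - τ x W := fun x Z W => by
    simp [hτ, mul_sub, Finset.sum_sub_distrib]
  have τzero : ∀ x, τ x 0 = 0 := fun x => by simp [hτ]
  have τsum : ∀ {J : Type} (s : Finset J) (x) (Z : J → V →L[ℂ] V),
      τ x (∑ j ∈ s, Z j) = ∑ j ∈ s, τ x (Z j) := fun s x Z => by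
    simp only [hτ, sum_apply, inner_sum, Complex.re_sum, Finset.mul_sum]
    exact Finset.sum_comm
  have τsumA : ∀ (x) (Z : A → V →L[ℂ] V), τ x (∑ j, Z j) = ∑ j, τ x (Z j) := fun x Z => by
    simp only [hτ, sum_apply, inner_sum, Complex.re_sum, Finset.mul_sum]
    exact Finset.sum_comm
  set σ : (Fin m → A) → (V →L[ℂ] V) → ℝ := fun x Z =>
    ∑ l, Real.exp (κ * α x l) * ‖Z (u x l)‖ ^ 2 with hσ
  have σneg : ∀ x Z W, σ x (Z - W) = σ x (W - Z) := fun x Z W => by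
    rw [hσ]; simp only [← neg_sub W Z, neg_apply, norm_neg]
  have hXs : ∀ (x : Fin m → A) y z, ⟪(∑ i, Y (x i)) y, z⟫_ℂ = ⟪y, (∑ i, Y (x i)) z⟫_ℂ := by
    intro x y z
    simp only [sum_apply, inner_sum, sum_inner, hYs]
  have lhs : ∀ x, ∑ l, α x l * Real.exp (κ * α x l) = ∑ i, τ x (Y (x i)) := by
    intro x
    rw [← τsum]
    refine Finset.sum_congr rfl fun l _ => ?_
    rw [hu, inner_smul_right, inner_self_eq_norm_sq_to_K, (u x).norm_eq_one]
    simp [mul_comm]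
  have coord : ∀ i, (Fintype.card A : ℝ) * (κ * ∑ x, τ x (Y (x i))) ≤
      κ ^ 2 / 2 * ∑ x : Fin m → A, ∑ b, σ x (Y (x i) - Y b) := by
    intro i
    -- Centring makes it free to subtract an independent copy `Y b`.
    have h1 : (Fintype.card A : ℝ) * ∑ x, τ x (Y (x i)) =
        ∑ x : Fin m → A, ∑ b, τ x (Y (x i) - Y b) := by
      rw [Finset.mul_sum]
      refine Finset.sum_congr rfl fun x _ => ?_
      simp only [τsub, Finset.sum_sub_distrib]
      rw [← τsumA x Y, hY0, τzero]
      simp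
    -- Averaging with the swapped pair turns `e^{κX}` into the difference of two exponentials, as
    -- the mean value inequality requires.
    have h2 := sum_sum_update_swap i (fun x b => τ x (Y (x i) - Y b))
    have h3 := sum_sum_update_swap i (fun x b => σ x (Y (x i) - Y b))
    have h4 : ∀ (x : Fin m → A) b, κ * (τ x (Y (x i) - Y b) +
        τ (Function.update x i b) (Y (Function.update x i b i) - Y (x i))) ≤
        κ ^ 2 / 2 * (σ x (Y (x i) - Y b) +
          σ (Function.update x i b) (Y (Function.update x i b i) - Y (x i))) := by
      intro x b
      have hd : ∑ j, Y (x j) - ∑ j, Y (Function.update x i b j) = Y (x i) - Y b := by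
        rw [← Finset.sum_sub_distrib, Finset.sum_eq_single i]
        · simp
        · intro j _ hj; simp [Function.update_of_ne hj]
        · simp
      have := mean_value_trace_exp (u x) (u (Function.update x i b)) (hu x)
        (hu (Function.update x i b)) (hXs _) (hXs _) κ
      rw [hd] at this
      rw [Function.update_self, σneg (Function.update x i b), τsub (Function.update x i b)]
      have h5 := τsub (Function.update x i b) (Y (x i)) (Y b)
      simp only [hτ, hσ] at this h5 ⊢
      rw [h5] at this
      linarith
    have h6 := Finset.sum_le_sum fun x (_ : x ∈ Finset.univ) =>
      Finset.sum_le_sum fun b (_ : b ∈ (Finset.univ : Finset A)) => h4 x b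
    simp only [← Finset.mul_sum, Finset.sum_add_distrib, h2, h3] at h6
    rw [mul_left_comm, h1]
    linarith
  have h7 := Finset.sum_le_sum fun i (_ : i ∈ (Finset.univ : Finset (Fin m))) => coord i
  simp only [← Finset.mul_sum] at h7
  rw [Finset.sum_comm] at h7
  simp only [lhs]
  refine h7.trans (le_of_eq ?_)
  congr 1
  rw [Finset.sum_comm]
  refine Finset.sum_congr rfl fun x _ => ?_
  simp only [hσ, Finset.mul_sum]
  rw [Finset.sum_comm' (t' := Finset.univ) (s' := fun _ => Finset.univ) (by simp)]
  conv_lhs => rw [Finset.sum_comm]; enter [2, b]; rw [Finset.sum_comm]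
  rw [Finset.sum_comm]

end Exchange

/-! ### From a differential inequality to a tail bound -/

section Laplace

/-- A Grönwall argument for the moment generating function of a finite family of reals. -/
theorem sum_exp_le_of_deriv_bound {P : Type*} [Fintype P] {l : P → ℝ} {c B : ℝ} (hc : 0 ≤ c)
    (hB : 0 ≤ B)
    (h : ∀ κ : ℝ, κ * ∑ p, l p * Real.exp (κ * l p) ≤
      κ ^ 2 * c * (∑ p, l p * Real.exp (κ * l p) + 2 * B * ∑ p, Real.exp (κ * l p)))
    {κ : ℝ} (hκ : |κ| * c ≤ 1 / 2) :
    ∑ p, Real.exp (κ * l p) ≤ Fintype.card P * Real.exp (2 * B * c * κ ^ 2) := by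
  have hF : ∀ κ : ℝ, 0 ≤ ∑ p, Real.exp (κ * l p) := fun κ =>
    Finset.sum_nonneg fun p _ => (Real.exp_pos _).le
  -- As `κc ≤ 1/2`, at most half of the left side reappears on the right and is absorbed; this
  -- doubles `2B` to `4B`.
  have h' : ∀ κ : ℝ, |κ| * c ≤ 1 / 2 →
      κ * ∑ p, l p * Real.exp (κ * l p) ≤ 4 * B * c * κ ^ 2 * ∑ p, Real.exp (κ * l p) := by
    intro κ hκ
    have h1 := h κ
    have h2 : κ * c ≤ 1 / 2 := (mul_le_mul_of_nonneg_right (le_abs_self κ) hc).trans hκ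
    have h3 : 0 ≤ 4 * B * c * κ ^ 2 * ∑ p, Real.exp (κ * l p) :=
      mul_nonneg (by positivity) (hF κ)
    rcases le_or_gt (κ * ∑ p, l p * Real.exp (κ * l p)) 0 with h4 | h4
    · linarith
    · have h5 := mul_le_mul_of_nonneg_right h2 h4.le
      linarith
  -- Following the segment `s ↦ sκ`, `s ∈ [0, 1]`, treats both signs of `κ` at once.
  have hd : ∀ s : ℝ, HasDerivAt
      (fun s => (∑ p, Real.exp (s * κ * l p)) * Real.exp (-(2 * B * c * κ ^ 2 * s ^ 2)))
      ((∑ p, Real.exp (s * κ * l p) * (κ * l p)) * Real.exp (-(2 * B * c * κ ^ 2 * s ^ 2)) +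
        (∑ p, Real.exp (s * κ * l p)) * (Real.exp (-(2 * B * c * κ ^ 2 * s ^ 2)) *
          -(2 * B * c * κ ^ 2 * (2 * s)))) s := by
    intro s
    refine HasDerivAt.mul (HasDerivAt.fun_sum fun p _ => ?_) ?_
    · have := (((hasDerivAt_id s).mul_const κ).mul_const (l p)).exp
      simpa using this
    · have := (((hasDerivAt_id s).pow 2).const_mul (2 * B * c * κ ^ 2)).neg.exp
      simpa using this
  have hanti := antitoneOn_of_deriv_nonpos (convex_Icc (0 : ℝ) 1)
    (fun s _ => (hd s).continuousAt.continuousWithinAt)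
    (fun s _ => (hd s).differentiableAt.differentiableWithinAt) (by
      intro s hs
      rw [interior_Icc] at hs
      rw [(hd s).deriv]
      have hs2 : |s * κ| * c ≤ 1 / 2 := by
        rw [abs_mul, abs_of_pos hs.1, mul_assoc]
        exact (mul_le_of_le_one_left (by positivity) hs.2.le).trans hκ
      have h1 := h' (s * κ) hs2
      have h2 : ∑ p, Real.exp (s * κ * l p) * (κ * l p) =
          κ * ∑ p, l p * Real.exp (s * κ * l p) := by
        rw [Finset.mul_sum]
        exact Finset.sum_congr rfl fun p _ => by ring
      rw [h2]
      have h3 : κ * ∑ p, l p * Real.exp (s * κ * l p) ≤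
          4 * B * c * κ ^ 2 * s * ∑ p, Real.exp (s * κ * l p) := by
        refine le_of_mul_le_mul_left ?_ hs.1
        linarith
      have h4 := mul_le_mul_of_nonneg_right h3 (Real.exp_pos (-(2 * B * c * κ ^ 2 * s ^ 2))).le
      linarith)
  have := hanti (Set.left_mem_Icc.2 zero_le_one) (Set.right_mem_Icc.2 zero_le_one) zero_le_one
  simp only [one_mul, zero_mul, Real.exp_zero, one_pow, mul_one, ne_eq, OfNat.ofNat_ne_zero,
    not_false_eq_true, zero_pow, mul_zero, neg_zero, Finset.sum_const, Finset.card_univ,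
    nsmul_eq_mul] at this
  rw [Real.exp_neg] at this
  exact (mul_inv_le_iff₀ (Real.exp_pos _)).1 this

/-- The Laplace transform bound for the number of samples with a large eigenvalue. -/
theorem card_exists_lt_abs_mul_exp_le {X ι : Type*} [Fintype X] [Fintype ι] (l : X → ι → ℝ)
    {κ t : ℝ} (hκ : 0 ≤ κ) (S : Finset X) (hS : ∀ x ∈ S, ∃ i, t ≤ |l x i|) :
    (S.card : ℝ) * Real.exp (κ * t) ≤
      ∑ p : X × ι, Real.exp (κ * l p.1 p.2) + ∑ p : X × ι, Real.exp (-κ * l p.1 p.2) := by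
  rw [← Finset.sum_add_distrib, Fintype.sum_prod_type, ← nsmul_eq_mul]
  refine le_trans (Finset.card_nsmul_le_sum S
    (fun x => ∑ i, (Real.exp (κ * l x i) + Real.exp (-κ * l x i))) _ ?_)
    (Finset.sum_le_univ_sum_of_nonneg fun x => by positivity)
  intro x hx
  obtain ⟨i, hi⟩ := hS x hx
  refine le_trans ?_ (Finset.single_le_sum (f := fun i => Real.exp (κ * l x i) +
    Real.exp (-κ * l x i)) (fun i _ => by positivity) (Finset.mem_univ i))
  rcases le_abs'.1 hi with h | h
  · have : Real.exp (κ * t) ≤ Real.exp (-κ * l x i) :=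
      Real.exp_le_exp.2 (by linarith [mul_le_mul_of_nonneg_left h hκ])
    linarith [Real.exp_pos (κ * l x i)]
  · have : Real.exp (κ * t) ≤ Real.exp (κ * l x i) :=
      Real.exp_le_exp.2 (mul_le_mul_of_nonneg_left h hκ)
    linarith [Real.exp_pos (-κ * l x i)]

end Laplace

/-! ### Empirical sums of rank one operators -/

section Empirical

variable {V : Type*} [NormedAddCommGroup V] [InnerProductSpace ℂ V]
  {A : Type*} [Fintype A] {m : ℕ}

open InnerProductSpace

/-- The deviation of the rescaled empirical sum of the operators `⟪u_a, ·⟫ v_a` over the sample `x`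
from their sum over all `a`. -/
noncomputable def empiricalDeviation (u v : A → V) (x : Fin m → A) : V →L[ℂ] V :=
  ((Fintype.card A / m : ℝ) : ℂ) • ∑ i, rankOne ℂ (v (x i)) (u (x i)) -
    ∑ a, rankOne ℂ (v a) (u a)

/-- The centred summand of `empiricalDeviation w w`. -/
noncomputable def centredRankOne (m : ℕ) (w : A → V) (a : A) : V →L[ℂ] V :=
  ((Fintype.card A / m : ℝ) : ℂ) • rankOne ℂ (w a) (w a) -
    ((1 / m : ℝ) : ℂ) • ∑ b, rankOne ℂ (w b) (w b)

theorem sum_centredRankOne (m : ℕ) (w : A → V) : ∑ a, centredRankOne m w a = 0 := by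
  simp only [centredRankOne, Finset.sum_sub_distrib, ← Finset.smul_sum, Finset.sum_const,
    Finset.card_univ, ← Nat.cast_smul_eq_nsmul ℂ, smul_smul]
  rw [← sub_smul]
  simp [div_eq_mul_inv, mul_comm]

theorem sum_centredRankOne_sample (hm : 0 < m) (w : A → V) (x : Fin m → A) :
    ∑ i, centredRankOne m w (x i) = empiricalDeviation w w x := by
  have : (m : ℂ) ≠ 0 := by exact_mod_cast hm.ne'
  simp only [centredRankOne, empiricalDeviation, Finset.sum_sub_distrib, ← Finset.smul_sum,
    Finset.sum_const, Finset.card_univ, ← Nat.cast_smul_eq_nsmul ℂ, smul_smul, Fintype.card_fin]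
  simp [this]

theorem inner_centredRankOne (m : ℕ) (w : A → V) (a : A) (y z : V) :
    ⟪centredRankOne m w a y, z⟫_ℂ = ⟪y, centredRankOne m w a z⟫_ℂ := by
  simp only [centredRankOne, sub_apply, smul_apply, sum_apply, rankOne_apply, inner_sub_left,
    inner_sub_right, inner_smul_left, inner_smul_right, sum_inner, inner_sum, inner_conj_symm,
    Complex.conj_ofReal]
  simp only [mul_comm]

theorem centredRankOne_sub_apply (m : ℕ) (w : A → V) (a b : A) (z : V) :
    (centredRankOne m w a - centredRankOne m w b) z =
      ((Fintype.card A / m : ℝ) : ℂ) • (⟪w a, z⟫_ℂ • w a - ⟪w b, z⟫_ℂ • w b) := by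
  simp only [centredRankOne, sub_sub_sub_cancel_right, sub_apply, smul_apply, rankOne_apply,
    smul_sub]

/-- The common mean cancels in the difference. Each remaining rank one term spends one factor `‖w‖²`
on `K` and leaves a quadratic form in `z`. -/
theorem norm_centredRankOne_sub_apply_sq_le {w : A → V} {K : ℝ} (hK : ∀ a, ‖w a‖ ^ 2 ≤ K)
    (a b : A) (z : V) :
    ‖(centredRankOne m w a - centredRankOne m w b) z‖ ^ 2 ≤
      2 * (Fintype.card A / m : ℝ) ^ 2 * K * (‖⟪w a, z⟫_ℂ‖ ^ 2 + ‖⟪w b, z⟫_ℂ‖ ^ 2) := by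
  rw [centredRankOne_sub_apply, norm_smul, mul_pow, Complex.norm_real, Real.norm_eq_abs, sq_abs]
  have h1 := norm_sub_le (⟪w a, z⟫_ℂ • w a) (⟪w b, z⟫_ℂ • w b)
  have h2 : ‖⟪w a, z⟫_ℂ • w a - ⟪w b, z⟫_ℂ • w b‖ ^ 2 ≤
      2 * (‖⟪w a, z⟫_ℂ • w a‖ ^ 2 + ‖⟪w b, z⟫_ℂ • w b‖ ^ 2) :=
    (pow_le_pow_left₀ (norm_nonneg _) h1 2).trans add_sq_le
  rw [norm_smul, norm_smul, mul_pow, mul_pow] at h2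
  have h3 := mul_le_mul_of_nonneg_left (hK a) (sq_nonneg ‖⟪w a, z⟫_ℂ‖)
  have h4 := mul_le_mul_of_nonneg_left (hK b) (sq_nonneg ‖⟪w b, z⟫_ℂ‖)
  calc _ ≤ (Fintype.card A / m : ℝ) ^ 2 *
        (2 * (‖⟪w a, z⟫_ℂ‖ ^ 2 * K + ‖⟪w b, z⟫_ℂ‖ ^ 2 * K)) := by gcongr; linarith
    _ = _ := by ring

theorem re_inner_empiricalDeviation (w : A → V) (x : Fin m → A) (z : V) :
    (⟪z, empiricalDeviation w w x z⟫_ℂ).re =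
      (Fintype.card A / m : ℝ) * ∑ i, ‖⟪w (x i), z⟫_ℂ‖ ^ 2 - ∑ a, ‖⟪w a, z⟫_ℂ‖ ^ 2 := by
  have h : ∀ a, ⟪w a, z⟫_ℂ * ⟪z, w a⟫_ℂ = ((‖⟪w a, z⟫_ℂ‖ ^ 2 : ℝ) : ℂ) := fun a => by
    rw [← inner_conj_symm z, Complex.mul_conj, Complex.normSq_eq_norm_sq]
  simp only [empiricalDeviation, sub_apply, smul_apply, sum_apply, rankOne_apply,
    inner_sub_right, inner_smul_right, inner_sum, h]
  rw [← Complex.ofReal_sum, ← Complex.ofReal_sum, ← Complex.ofReal_mul, ← Complex.ofReal_sub,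
    Complex.ofReal_re]

variable {ι : Type*} [Fintype ι]

/-- The rank one structure makes the variance self-bounding: the sampled quadratic forms at a unit
eigenvector sum, up to scaling, to the eigenvalue plus the full quadratic form, and the latter is at
most `B`. -/
theorem deriv_bound_empiricalDeviation [Nonempty A] (hm : 0 < m) {w : A → V} {K B : ℝ}
    (hK : ∀ a, ‖w a‖ ^ 2 ≤ K) (hB : ∀ z, ∑ a, ‖⟪w a, z⟫_ℂ‖ ^ 2 ≤ B * ‖z‖ ^ 2)
    (u : (Fin m → A) → OrthonormalBasis ι ℂ V) (α : (Fin m → A) → ι → ℝ)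
    (hu : ∀ x l, empiricalDeviation w w x (u x l) = (α x l : ℂ) • u x l) (κ : ℝ) :
    κ * ∑ x, ∑ l, α x l * Real.exp (κ * α x l) ≤
      κ ^ 2 * (Fintype.card A * K / m) * (∑ x, ∑ l, α x l * Real.exp (κ * α x l) +
        2 * B * ∑ x, ∑ l, Real.exp (κ * α x l)) := by
  have hN : (0 : ℝ) < Fintype.card A := by exact_mod_cast Fintype.card_pos
  have hm' : (0 : ℝ) < m := by exact_mod_cast hm
  have hK0 : 0 ≤ K := (sq_nonneg _).trans (hK (Classical.arbitrary A))
  have main := exchangeable_pairs_bound (m := m) (inner_centredRankOne m w)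
    (sum_centredRankOne m w) u α
    (fun x l => by rw [sum_centredRankOne_sample hm]; exact hu x l) κ
  have term : ∀ x l, ∑ i, ∑ b, ‖(centredRankOne m w (x i) - centredRankOne m w b) (u x l)‖ ^ 2 ≤
      2 * (Fintype.card A : ℝ) ^ 2 * K / m * (α x l + 2 * B) := by
    intro x l
    have hα : α x l = (Fintype.card A / m : ℝ) * ∑ i, ‖⟪w (x i), u x l⟫_ℂ‖ ^ 2 -
        ∑ a, ‖⟪w a, u x l⟫_ℂ‖ ^ 2 := by
      rw [← re_inner_empiricalDeviation, hu, inner_smul_right, inner_self_eq_norm_sq_to_K,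
        (u x).norm_eq_one]
      simp
    have hQ := hB (u x l)
    rw [(u x).norm_eq_one, one_pow, mul_one] at hQ
    refine (Finset.sum_le_sum fun i _ => Finset.sum_le_sum fun b _ =>
      norm_centredRankOne_sub_apply_sq_le hK (x i) b (u x l)).trans ?_
    simp only [← Finset.mul_sum, Finset.sum_add_distrib, Finset.sum_const, Finset.card_univ,
      nsmul_eq_mul, Fintype.card_fin]
    have e : 2 * (Fintype.card A / m : ℝ) ^ 2 * K *
        (Fintype.card A * ∑ i, ‖⟪w (x i), u x l⟫_ℂ‖ ^ 2 + m * ∑ a, ‖⟪w a, u x l⟫_ℂ‖ ^ 2) =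
        2 * (Fintype.card A : ℝ) ^ 2 * K / m * (α x l + 2 * ∑ a, ‖⟪w a, u x l⟫_ℂ‖ ^ 2) := by
      rw [hα]; field_simp; ring
    rw [e]
    gcongr
  have h2 : ∑ x, ∑ l, Real.exp (κ * α x l) *
      ∑ i, ∑ b, ‖(centredRankOne m w (x i) - centredRankOne m w b) (u x l)‖ ^ 2 ≤
      2 * (Fintype.card A : ℝ) ^ 2 * K / m * (∑ x, ∑ l, α x l * Real.exp (κ * α x l) +
        2 * B * ∑ x, ∑ l, Real.exp (κ * α x l)) := by
    refine (Finset.sum_le_sum fun x _ => Finset.sum_le_sum fun l _ =>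
      mul_le_mul_of_nonneg_left (term x l) (Real.exp_pos _).le).trans (le_of_eq ?_)
    simp only [Finset.mul_sum, ← Finset.sum_add_distrib]
    exact Finset.sum_congr rfl fun x _ => Finset.sum_congr rfl fun l _ => by ring
  have h3 := main.trans (mul_le_mul_of_nonneg_left h2 (by positivity : 0 ≤ κ ^ 2 / 2))
  refine le_of_mul_le_mul_left (h3.trans (le_of_eq ?_)) hN
  field_simp

end Empirical

/-! ### Tail bounds and polarization -/

section Tail

open InnerProductSpace

variable {V : Type*} [NormedAddCommGroup V] [InnerProductSpace ℂ V]
  {A : Type*} [Fintype A] {m : ℕ}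

theorem OrthonormalBasis.opNorm_le_of_apply_eq_smul {ι : Type*} [Fintype ι]
    (u : OrthonormalBasis ι ℂ V) {α : ι → ℝ} {T : V →L[ℂ] V}
    (hT : ∀ i, T (u i) = (α i : ℂ) • u i) {t : ℝ} (ht : 0 ≤ t) (hα : ∀ i, |α i| ≤ t) :
    ‖T‖ ≤ t := by
  refine T.opNorm_le_bound ht fun y => ?_
  refine le_of_sq_le_sq ?_ (by positivity)
  have hy : T y = ∑ i, ((α i : ℂ) * ⟪u i, y⟫_ℂ) • u i := by
    conv_lhs => rw [← u.sum_repr' y]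
    simp only [map_sum, map_smul, hT, smul_smul, mul_comm]
  rw [← u.sum_sq_norm_inner_right, mul_pow, ← u.sum_sq_norm_inner_right y, Finset.mul_sum]
  refine Finset.sum_le_sum fun i _ => ?_
  rw [hy, u.orthonormal.inner_right_fintype, norm_mul, mul_pow, Complex.norm_real,
    Real.norm_eq_abs]
  gcongr
  exact hα i

theorem card_norm_empiricalDeviation_mul_exp_le_finrank [FiniteDimensional ℂ V] [Nonempty A]
    (hm : 0 < m) {w : A → V} {K B : ℝ}
    (hK : ∀ a, ‖w a‖ ^ 2 ≤ K) (hB0 : 0 ≤ B) (hB : ∀ z, ∑ a, ‖⟪w a, z⟫_ℂ‖ ^ 2 ≤ B * ‖z‖ ^ 2)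
    {κ t : ℝ} (hκ : 0 ≤ κ) (ht : 0 ≤ t) (hκc : κ * (Fintype.card A * K / m) ≤ 1 / 2)
    (S : Finset (Fin m → A)) (hS : ∀ x ∈ S, t < ‖empiricalDeviation w w x‖) :
    (S.card : ℝ) * Real.exp (κ * t) ≤ 2 * ((Fintype.card A : ℝ) ^ m * Module.finrank ℂ V *
      Real.exp (2 * B * (Fintype.card A * K / m) * κ ^ 2)) := by
  have hK0 : 0 ≤ K := (sq_nonneg _).trans (hK (Classical.arbitrary A))
  have hsymm : ∀ x : Fin m → A,
      (empiricalDeviation w w x : V →ₗ[ℂ] V).IsSymmetric := by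
    intro x y z
    rw [← sum_centredRankOne_sample hm]
    simp only [ContinuousLinearMap.coe_coe, sum_apply, sum_inner, inner_sum, inner_centredRankOne]
  let u := fun x => (hsymm x).eigenvectorBasis rfl
  let α := fun x => (hsymm x).eigenvalues rfl
  have hu : ∀ x l, empiricalDeviation w w x (u x l) = (α x l : ℂ) • u x l :=
    fun x l => (hsymm x).apply_eigenvectorBasis rfl l
  have hmgf : ∀ κ : ℝ, |κ| * (Fintype.card A * K / m) ≤ 1 / 2 →
      ∑ p : (Fin m → A) × _, Real.exp (κ * α p.1 p.2) ≤ _ := fun κ hκ =>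
    sum_exp_le_of_deriv_bound (B := B) (by positivity) hB0 (fun κ => by
      rw [Fintype.sum_prod_type, Fintype.sum_prod_type]
      exact deriv_bound_empiricalDeviation hm hK hB u α hu κ) hκ
  have h1 := card_exists_lt_abs_mul_exp_le α hκ S (t := t) (by
    intro x hx
    by_contra! hcon
    exact absurd ((u x).opNorm_le_of_apply_eq_smul (hu x) ht fun i => (hcon i).le)
      (not_le.2 (hS x hx)))
  have h2 := hmgf κ (by rwa [abs_of_nonneg hκ])
  have h3 := hmgf (-κ) (by rwa [abs_neg, abs_of_nonneg hκ])
  rw [neg_sq] at h3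
  rw [Fintype.card_prod, Fintype.card_fun, Fintype.card_fin, Fintype.card_fin] at h2 h3
  push_cast at h2 h3
  linarith

/-- The operator factors through the orthogonal projection onto the span of the `w a`. This replaces
the ambient dimension in the trace bound by at most `Fintype.card A`. -/
theorem norm_empiricalDeviation_le_span (w : A → V) (x : Fin m → A)
    [(Submodule.span ℂ (Set.range w)).HasOrthogonalProjection] :
    ‖empiricalDeviation w w x‖ ≤ ‖empiricalDeviation
      (fun a => (⟨w a, Submodule.subset_span ⟨a, rfl⟩⟩ : Submodule.span ℂ (Set.range w)))
      (fun a => ⟨w a, Submodule.subset_span ⟨a, rfl⟩⟩) x‖ := by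
  set U := Submodule.span ℂ (Set.range w)
  set w' : A → U := fun a => ⟨w a, Submodule.subset_span ⟨a, rfl⟩⟩
  refine ContinuousLinearMap.opNorm_le_bound _ (norm_nonneg _) fun y => ?_
  have hin : ∀ a, ⟪w a, y⟫_ℂ = ⟪w' a, U.orthogonalProjectionOnto y⟫_ℂ := fun a =>
    (U.inner_orthogonalProjectionOnto_eq_of_mem_left (w' a) y).symm
  have : empiricalDeviation w w x y =
      (empiricalDeviation w' w' x (U.orthogonalProjectionOnto y) : V) := by
    simp only [empiricalDeviation, sub_apply, smul_apply, sum_apply, rankOne_apply, hin,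
      Submodule.coe_sub, Submodule.coe_smul, Submodule.coe_sum, w']
  rw [this, ← Submodule.coe_norm]
  refine (ContinuousLinearMap.le_opNorm _ _).trans ?_
  gcongr
  exact U.norm_orthogonalProjectionOnto_apply_le y

/-- Tail bound for the empirical deviation of a family of rank one operators, counting samples. -/
theorem card_norm_empiricalDeviation_mul_exp_le [Nonempty A]
    (hm : 0 < m) {w : A → V} {K B : ℝ}
    (hK : ∀ a, ‖w a‖ ^ 2 ≤ K) (hB0 : 0 ≤ B) (hB : ∀ z, ∑ a, ‖⟪w a, z⟫_ℂ‖ ^ 2 ≤ B * ‖z‖ ^ 2)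
    {κ t : ℝ} (hκ : 0 ≤ κ) (ht : 0 ≤ t) (hκc : κ * (Fintype.card A * K / m) ≤ 1 / 2)
    (S : Finset (Fin m → A)) (hS : ∀ x ∈ S, t < ‖empiricalDeviation w w x‖) :
    (S.card : ℝ) * Real.exp (κ * t) ≤ 2 * ((Fintype.card A : ℝ) ^ m * Fintype.card A *
      Real.exp (2 * B * (Fintype.card A * K / m) * κ ^ 2)) := by
  have := FiniteDimensional.span_of_finite ℂ (Set.finite_range w)
  refine (card_norm_empiricalDeviation_mul_exp_le_finrank hm
    (w := fun a => (⟨w a, Submodule.subset_span ⟨a, rfl⟩⟩ : Submodule.span ℂ (Set.range w)))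
    hK hB0 (fun z => hB z) hκ ht hκc S
    fun x hx => (hS x hx).trans_le (norm_empiricalDeviation_le_span w x)).trans ?_
  gcongr
  exact finrank_range_le_card w

/-- Polarization. -/
theorem empiricalDeviation_polarization (u v : A → V) (x : Fin m → A) :
    (4 : ℂ) • empiricalDeviation u v x =
      ∑ k : Fin 4, Complex.I ^ (k : ℕ) •
        empiricalDeviation (fun a => v a + Complex.I ^ (k : ℕ) • u a)
          (fun a => v a + Complex.I ^ (k : ℕ) • u a) x := by
  have h : ∀ a, (4 : ℂ) • rankOne ℂ (v a) (u a) = ∑ k : Fin 4, Complex.I ^ (k : ℕ) •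
      rankOne ℂ (v a + Complex.I ^ (k : ℕ) • u a) (v a + Complex.I ^ (k : ℕ) • u a) := by
    intro a
    ext y
    have hI3 : Complex.I ^ 3 = -Complex.I := Complex.I_pow_three
    simp only [Fin.sum_univ_four, Fin.val_zero, Fin.val_one, Fin.val_two, pow_zero, pow_one,
      Complex.I_sq, smul_apply, add_apply, rankOne_apply, inner_add_left, inner_smul_left, one_smul,
      show ((3 : Fin 4) : ℕ) = 3 from rfl, hI3, map_neg, map_one, Complex.conj_I]
    match_scalars
    · linear_combination 2 * ⟪u a, y⟫_ℂ * Complex.I_sq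
    · linear_combination -2 * ⟪v a, y⟫_ℂ * Complex.I_sq
  simp only [empiricalDeviation, smul_sub, Finset.sum_sub_distrib]
  congr 1
  · rw [smul_comm, Finset.smul_sum]
    simp only [h]
    simp only [smul_comm (Complex.I ^ _) ((Fintype.card A / m : ℝ) : ℂ), ← Finset.smul_sum]
    rw [Finset.sum_comm]
    simp only [← Finset.smul_sum]
  · simp only [Finset.smul_sum, h]
    rw [Finset.sum_comm]

theorem exists_lt_norm_empiricalDeviation {u v : A → V} {x : Fin m → A} {t : ℝ}
    (h : t < ‖empiricalDeviation u v x‖) :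
    ∃ k : Fin 4, t < ‖empiricalDeviation (fun a => v a + Complex.I ^ (k : ℕ) • u a)
          (fun a => v a + Complex.I ^ (k : ℕ) • u a) x‖ := by
  by_contra! hcon
  have h1 : ‖(4 : ℂ) • empiricalDeviation u v x‖ ≤ ∑ _k : Fin 4, t := by
    rw [empiricalDeviation_polarization]
    refine norm_sum_le_of_le _ fun k _ => ?_
    rw [norm_smul, norm_pow, Complex.norm_I, one_pow, one_mul]
    exact hcon k
  rw [norm_smul] at h1
  simp at h1
  linarith

/-- Moving `P` and `Q` to the other argument reduces this to Bessel's inequality for a vector of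
norm at most `2‖z‖`. -/
theorem Orthonormal.sum_norm_inner_apply_sq_le [CompleteSpace V] {h : A → V} (ho : Orthonormal ℂ h)
    {P Q : V →L[ℂ] V} (hP : IsStarProjection P) (hQ : IsStarProjection Q) {c : ℂ}
    (hc : ‖c‖ = 1) (z : V) :
    ∑ a, ‖⟪Q (h a) + c • P (h a), z⟫_ℂ‖ ^ 2 ≤ 4 * ‖z‖ ^ 2 := by
  have h1 : ∀ a, ⟪Q (h a) + c • P (h a), z⟫_ℂ =
      ⟪h a, Q z + (starRingEnd ℂ c) • P z⟫_ℂ := by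
    intro a
    have e1 := hP.isSelfAdjoint.isSymmetric (h a) z
    have e2 := hQ.isSelfAdjoint.isSymmetric (h a) z
    simp only [ContinuousLinearMap.coe_coe] at e1 e2
    rw [inner_add_left, inner_smul_left, inner_add_right, inner_smul_right, e1, e2]
  simp only [h1]
  refine (ho.sum_inner_products_le _).trans ?_
  have hn : ∀ {R : V →L[ℂ] V}, IsStarProjection R → ‖R z‖ ≤ ‖z‖ := fun {R} hR =>
    (R.le_of_opNorm_le hR.norm_le z).trans (by simp)
  have : ‖Q z + (starRingEnd ℂ c) • P z‖ ≤ 2 * ‖z‖ := by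
    refine (norm_add_le _ _).trans ?_
    rw [norm_smul, RCLike.norm_conj, hc, one_mul]
    linarith [hn hP, hn hQ]
  calc _ ≤ (2 * ‖z‖) ^ 2 := by gcongr
    _ = _ := by ring

/-- The sampling deviation is large only for a small proportion of all samples. -/
theorem card_norm_empiricalDeviation_le [CompleteSpace V] {h : A → V} (ho : Orthonormal ℂ h)
    (hA : 2 ≤ Fintype.card A) (hm : 0 < m)
    {P Q : V →L[ℂ] V} (hP : IsStarProjection P) (hQ : IsStarProjection Q) {q : ℝ}
    (hPq : ∀ a, ‖P (h a)‖ ^ 2 ≤ q) (hQq : ∀ a, ‖Q (h a)‖ ^ 2 ≤ q)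
    (hmq : 13 * (q * Fintype.card A * Real.log (Fintype.card A)) ≤ m)
    (S : Finset (Fin m → A))
    (hS : ∀ x ∈ S, 28 * √(q * Fintype.card A * Real.log (Fintype.card A) / m) <
      ‖empiricalDeviation (fun a => P (h a)) (fun a => Q (h a)) x‖) :
    (S.card : ℝ) ≤ (Fintype.card A : ℝ) ^ m * ((Fintype.card A : ℝ) ^ 2)⁻¹ := by
  classical
  have : Nonempty A := Fintype.card_pos_iff.1 (by omega)
  set N : ℝ := (Fintype.card A : ℝ) with hN
  have hN2 : 2 ≤ N := by rw [hN]; exact_mod_cast hA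
  have hm' : (0 : ℝ) < m := by exact_mod_cast hm
  have hlog : 0 < Real.log N := Real.log_pos (by linarith)
  have hq0 : 0 ≤ q := (sq_nonneg _).trans (hPq (Classical.arbitrary A))
  -- For `q = 0` the deviation vanishes; otherwise `c > 0`, so `κ` below may be divided by it.
  rcases hq0.eq_or_lt with rfl | hq
  · have hS0 : S = ∅ := by
      refine Finset.eq_empty_of_forall_notMem fun x hx => absurd (hS x hx) (not_lt.2 ?_)
      have hz : ∀ a, P (h a) = 0 := fun a => by
        have := hPq a
        simpa using le_antisymm this (sq_nonneg _)
      simp [empiricalDeviation, hz]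
    simp [hS0]; positivity
  set t : ℝ := 28 * √(q * N * Real.log N / m) with ht
  have ht0 : 0 ≤ t := by positivity
  have ht2 : t ^ 2 = 784 * (q * N * Real.log N / m) := by
    rw [ht, mul_pow, Real.sq_sqrt (by positivity)]; norm_num
  set c : ℝ := N * (4 * q) / m with hc
  have hc0 : 0 < c := by positivity
  have ht2c : t ^ 2 = 196 * c * Real.log N := by rw [ht2, hc]; ring
  -- The constant 13 comes from here: `28² / 13 ≤ 64`, and `t ≤ 8` is exactly `κc ≤ 1/2` for the `κ`
  -- below.
  have ht8 : t ≤ 8 := by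
    have : q * N * Real.log N / m ≤ 1 / 13 := by
      rw [div_le_div_iff₀ hm' (by norm_num)]; linarith
    nlinarith
  let w : Fin 4 → A → V := fun k a => Q (h a) + Complex.I ^ (k : ℕ) • P (h a)
  have hI : ∀ k : Fin 4, ‖Complex.I ^ (k : ℕ)‖ = 1 := fun k => by simp
  have hsub : S ⊆ Finset.univ.biUnion fun k : Fin 4 =>
      S.filter fun x => t < ‖empiricalDeviation (w k) (w k) x‖ := by
    intro x hx
    obtain ⟨k, hk⟩ := exists_lt_norm_empiricalDeviation (hS x hx)
    simp only [Finset.mem_biUnion, Finset.mem_univ, true_and, Finset.mem_filter]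
    exact ⟨k, hx, hk⟩
  have hk : ∀ k, ((S.filter fun x => t < ‖empiricalDeviation (w k) (w k) x‖).card : ℝ) ≤
      N ^ m * (N ^ 2)⁻¹ / 4 := by
    intro k
    have hwK : ∀ a, ‖w k a‖ ^ 2 ≤ 4 * q := by
      intro a
      have h1 : ‖w k a‖ ^ 2 ≤ 2 * (‖Q (h a)‖ ^ 2 + ‖Complex.I ^ (k : ℕ) • P (h a)‖ ^ 2) :=
        (pow_le_pow_left₀ (norm_nonneg _) (norm_add_le _ _) 2).trans add_sq_le
      rw [norm_smul, hI, one_mul] at h1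
      linarith [hPq a, hQq a]
    -- `κ = t / (16c)` maximizes `κt - 2Bcκ²` for `B = 4`. The maximum `t² / (32c) = (98/16) log N`
    -- exceeds `6 log N`, which is what the constant 28 buys.
    have h1 := card_norm_empiricalDeviation_mul_exp_le hm hwK (by norm_num : (0 : ℝ) ≤ 4)
      (fun z => ho.sum_norm_inner_apply_sq_le hP hQ (hI k) z) (κ := t / (16 * c))
      (by positivity) ht0 (by
        change t / (16 * c) * c ≤ 1 / 2
        rw [div_mul_eq_mul_div, div_le_iff₀ (by positivity)]
        nlinarith)
      (S.filter fun x => t < ‖empiricalDeviation (w k) (w k) x‖)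
      (fun x hx => (Finset.mem_filter.1 hx).2)
    rw [← hN, ← hc] at h1
    have e1 : t / (16 * c) * t = 98 / 8 * Real.log N := by
      rw [div_mul_eq_mul_div, ← sq, ht2c]; field_simp; norm_num
    have e2 : 2 * 4 * c * (t / (16 * c)) ^ 2 = 98 / 16 * Real.log N := by
      rw [div_pow, ht2c]; field_simp; norm_num
    rw [e1, e2] at h1
    have e3 : Real.exp (98 / 8 * Real.log N) =
        Real.exp (98 / 16 * Real.log N) * Real.exp (98 / 16 * Real.log N) := by
      rw [← Real.exp_add]; congr 1; ring
    rw [e3, ← mul_assoc, ← mul_assoc] at h1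
    have h2 := le_of_mul_le_mul_right h1 (Real.exp_pos _)
    have h3 : N ^ 6 ≤ Real.exp (98 / 16 * Real.log N) := by
      calc N ^ 6 = Real.exp (6 * Real.log N) := by
            rw [mul_comm, Real.exp_mul, Real.exp_log (by linarith)]; norm_cast
        _ ≤ _ := Real.exp_le_exp.2 (by linarith)
    set s : ℝ := ((S.filter fun x => t < ‖empiricalDeviation (w k) (w k) x‖).card : ℝ)
    have h4 : s * N ^ 6 ≤ 2 * (N ^ m * N) :=
      (mul_le_mul_of_nonneg_left h3 (Nat.cast_nonneg _)).trans h2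
    -- The factor 8 is the two signs of the eigenvalue times the four polarization terms; `N ≥ 2`
    -- lets `N ^ 3` absorb it.
    have h8 : 8 ≤ N ^ 3 := by
      calc (8 : ℝ) = 2 ^ 3 := by norm_num
        _ ≤ N ^ 3 := by gcongr
    rw [← div_eq_mul_inv, div_div, le_div_iff₀ (by positivity)]
    have h5 : s * N ^ 5 ≤ 2 * N ^ m := by
      refine le_of_mul_le_mul_right ?_ (by linarith : (0 : ℝ) < N)
      linarith
    have h6 : s * N ^ 2 * 8 ≤ s * N ^ 2 * N ^ 3 :=
      mul_le_mul_of_nonneg_left h8 (by positivity)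
    linarith
  calc (S.card : ℝ) ≤ ∑ k : Fin 4,
        ((S.filter fun x => t < ‖empiricalDeviation (w k) (w k) x‖).card : ℝ) := by
        exact_mod_cast (Finset.card_le_card hsub).trans Finset.card_biUnion_le
    _ ≤ ∑ k : Fin 4, N ^ m * (N ^ 2)⁻¹ / 4 := Finset.sum_le_sum fun k _ => hk k
    _ = _ := by simp; ring

end Tail

/-! ### The Hankel basis and the sampling operator -/

section Hankel

variable {n₁ n₂ s : ℕ}

/-- The Hankel tensor basis, indexed by the entries of a signal matrix. -/
noncomputable def hankelFamily (n₁ n₂ s : ℕ) (p : Fin s × Fin (sigLen n₁ n₂)) :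
    Tensor3 n₁ n₂ s :=
  hankelTensorBasis n₁ n₂ s p.2 p.1

theorem hankelG_single (p : Fin s × Fin (sigLen n₁ n₂)) :
    hankelG n₁ n₂ s (EuclideanSpace.single p 1) = hankelFamily n₁ n₂ s p := by
  obtain ⟨j, k⟩ := p
  ext i
  simp only [hankelG, hankelLift, reweightInv, hankelFamily, hankelTensorBasis, hankelMatrixBasis,
    ContinuousLinearMap.comp_apply, LinearMap.coe_toContinuousLinearMap', LinearMap.coe_mk,
    AddHom.coe_mk, PiLp.single_apply, Prod.mk.injEq, Fin.ext_iff, Matrix.of_apply]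
  by_cases h1 : (i.2.2 : ℕ) = j <;> by_cases h2 : (i.1 : ℕ) + i.2.1 = k <;> simp [h1, h2]

/-- A position fixes both `i₃` and `i₁ + i₂`, so distinct basis tensors have disjoint supports; each
has `w_k` entries equal to `w_k^{-1/2}`. -/
theorem orthonormal_hankelFamily (h₁ : 0 < n₁) (h₂ : 0 < n₂) :
    Orthonormal ℂ (hankelFamily n₁ n₂ s) := by
  rw [orthonormal_iff_ite]
  rintro ⟨j, k⟩ ⟨j', k'⟩
  simp only [hankelFamily, hankelTensorBasis, hankelMatrixBasis, PiLp.inner_apply,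
    RCLike.inner_apply, Complex.conj_ofReal, ← Complex.ofReal_mul, ← Complex.ofReal_sum,
    Matrix.of_apply]
  split_ifs with h
  · obtain ⟨rfl, rfl⟩ := Prod.mk.inj h
    have hw : (0 : ℝ) < diagLen n₁ n₂ k := by exact_mod_cast diagLen_pos h₁ h₂ k
    have hs : (√(diagLen n₁ n₂ k : ℝ)) * √(diagLen n₁ n₂ k : ℝ) = diagLen n₁ n₂ k :=
      Real.mul_self_sqrt hw.le
    have hcount : ∑ i₁ : Fin n₁, ∑ i₂ : Fin n₂, (if (i₁ : ℕ) + i₂ = k then (1 : ℝ) else 0) =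
        diagLen n₁ n₂ k := by
      rw [← Fintype.sum_prod_type', Finset.sum_boole, diagLen]
    have hterm : ∀ i : Fin n₁ × Fin n₂ × Fin s,
        (1 / √(diagLen n₁ n₂ k : ℝ) * (if (i.1 : ℕ) + i.2.1 = k then 1 else 0) *
          if i.2.2 = j then 1 else 0) *
        (1 / √(diagLen n₁ n₂ k : ℝ) * (if (i.1 : ℕ) + i.2.1 = k then 1 else 0) *
          if i.2.2 = j then 1 else 0) = (diagLen n₁ n₂ k : ℝ)⁻¹ *
        ((if (i.1 : ℕ) + i.2.1 = k then 1 else 0) * if i.2.2 = j then 1 else 0) := by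
      intro i
      rw [← hs]
      split_ifs <;> simp [-Real.mul_self_sqrt]
    have htotal : ∑ i : Fin n₁ × Fin n₂ × Fin s,
        (if (i.1 : ℕ) + i.2.1 = k then (1 : ℝ) else 0) * (if i.2.2 = j then 1 else 0) =
        diagLen n₁ n₂ k := by
      rw [← hcount]
      simp [Fintype.sum_prod_type]
    rw [Finset.sum_congr rfl fun i _ => hterm i, ← Finset.mul_sum, htotal, inv_mul_cancel₀ hw.ne',
      Complex.ofReal_one]
  · rw [Complex.ofReal_eq_zero]
    refine Finset.sum_eq_zero fun i _ => ?_
    by_cases hi : i.2.2 = j ∧ (i.1 : ℕ) + i.2.1 = k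
    · by_cases hi' : i.2.2 = j' ∧ (i.1 : ℕ) + i.2.1 = k'
      · exact absurd (Prod.ext (hi.1.symm.trans hi'.1) (Fin.ext (hi.2.symm.trans hi'.2))) h
      · rcases not_and_or.1 hi' with h1 | h1 <;> simp only [h1, if_false, mul_zero, zero_mul]
    · rcases not_and_or.1 hi with h1 | h1 <;> simp only [h1, if_false, mul_zero, zero_mul]

theorem adjoint_hankelG_apply (z : Tensor3 n₁ n₂ s) (p : Fin s × Fin (sigLen n₁ n₂)) :
    ContinuousLinearMap.adjoint (hankelG n₁ n₂ s) z p = ⟪hankelFamily n₁ n₂ s p, z⟫_ℂ := by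
  rw [← hankelG_single, ← ContinuousLinearMap.adjoint_inner_right,
    EuclideanSpace.inner_single_left, map_one, one_mul]

theorem hankelG_apply (X : SigMat s (sigLen n₁ n₂)) :
    hankelG n₁ n₂ s X = ∑ p, X p • hankelFamily n₁ n₂ s p := by
  conv_lhs => rw [← (EuclideanSpace.basisFun _ ℂ).sum_repr X]
  simp [hankelG_single]

/-- The coordinates of `𝓖^* z` are `⟪h_p, z⟫`, so `𝓖 𝓟_p 𝓖^*` is the rank one operator of `h_p`;
self-adjointness moves `P₁` onto `h_p`. -/
theorem samplingDeviation_eq {m : ℕ} {P₁ P₂ : Tensor3 n₁ n₂ s →L[ℂ] Tensor3 n₁ n₂ s}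
    (hP₁ : IsStarProjection P₁) (a : Fin m → Fin s × Fin (sigLen n₁ n₂)) :
    samplingDeviation P₁ P₂ a = empiricalDeviation (fun p => P₁ (hankelFamily n₁ n₂ s p))
      (fun p => P₂ (hankelFamily n₁ n₂ s p)) a := by
  ext1 y
  have h1 : ∀ p, ⟪P₁ (hankelFamily n₁ n₂ s p), y⟫_ℂ = ⟪hankelFamily n₁ n₂ s p, P₁ y⟫_ℂ :=
    fun p => hP₁.isSelfAdjoint.isSymmetric (hankelFamily n₁ n₂ s p) y
  have hc : ((m : ℂ) / ((s : ℂ) * (sigLen n₁ n₂ : ℂ)))⁻¹ =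
      ((Fintype.card (Fin s × Fin (sigLen n₁ n₂)) / m : ℝ) : ℂ) := by
    simp only [Fintype.card_prod, Fintype.card_fin, inv_div]
    push_cast
    rfl
  simp only [samplingDeviation, hc, empiricalDeviation, ContinuousLinearMap.comp_apply, sub_apply,
    smul_apply, samplingOp, sum_apply, entryProj, ContinuousLinearMap.smulRight_apply,
    ContinuousLinearMap.id_apply, PiLp.proj_apply, adjoint_hankelG_apply, map_sub,
    map_smul, map_sum, hankelG_single, InnerProductSpace.rankOne_apply, h1]
  congr 1
  rw [hankelG_apply, map_sum]
  simp only [map_smul, adjoint_hankelG_apply]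

theorem norm_hankelTensorBasis_sq_le_basisMax (P : Tensor3 n₁ n₂ s →L[ℂ] Tensor3 n₁ n₂ s)
    (p : Fin s × Fin (sigLen n₁ n₂)) :
    ‖P (hankelFamily n₁ n₂ s p)‖ ^ 2 ≤ basisMax P ^ 2 := by
  have := le_ciSup (f := fun kj : Fin (sigLen n₁ n₂) × Fin s =>
    ‖P (hankelTensorBasis n₁ n₂ s kj.1 kj.2)‖) (Set.finite_range _).bddAbove (p.2, p.1)
  exact pow_le_pow_left₀ (norm_nonneg _) this 2

theorem measurable_basisMax :
    Measurable (basisMax : (Tensor3 n₁ n₂ s →L[ℂ] Tensor3 n₁ n₂ s) → ℝ) :=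
  Measurable.iSup fun kj => (ContinuousLinearMap.measurable_apply
    (hankelTensorBasis n₁ n₂ s kj.1 kj.2)).norm

theorem measurable_samplingDeviation {m : ℕ} (x : Fin m → Fin s × Fin (sigLen n₁ n₂)) :
    Measurable fun P : (Tensor3 n₁ n₂ s →L[ℂ] Tensor3 n₁ n₂ s) ×
      (Tensor3 n₁ n₂ s →L[ℂ] Tensor3 n₁ n₂ s) => ‖samplingDeviation P.1 P.2 x‖ := by
  have : Continuous fun P : (Tensor3 n₁ n₂ s →L[ℂ] Tensor3 n₁ n₂ s) ×
      (Tensor3 n₁ n₂ s →L[ℂ] Tensor3 n₁ n₂ s) => ‖samplingDeviation P.1 P.2 x‖ := by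
    unfold samplingDeviation
    fun_prop
  -- Second countability identifies the product σ-algebra with the Borel one, so continuity gives
  -- measurability.
  have : SecondCountableTopology (Tensor3 n₁ n₂ s →L[ℂ] Tensor3 n₁ n₂ s) :=
    by
    have := FiniteDimensional.proper ℂ (Tensor3 n₁ n₂ s →L[ℂ] Tensor3 n₁ n₂ s)
    infer_instance
  exact Continuous.measurable ‹_›

end Hankel

/-! ### Independence of the projections and the sample -/

section Sampling

/-- If `Z` is independent of a uniform sample `a` and for almost every value of `Z` at most a
proportion `δ` of all samples is bad, then a bad pair occurs with probability at most `δ`. -/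
theorem measureReal_bad_le_of_indepFun {Ω : Type*} [MeasurableSpace Ω] {μ : Measure Ω}
    [IsProbabilityMeasure μ] {A Z : Type*} [Fintype A] [Nonempty A] [MeasurableSpace A]
    [MeasurableSingletonClass A] [MeasurableSpace Z] {m : ℕ} {a : Fin m → Ω → A} {z : Ω → Z}
    (ha : ∀ i, Measurable (a i)) (hunif : ∀ i, μ.map (a i) = uniformOn Set.univ)
    (hind : iIndepFun a μ) (hz : Measurable z) (hza : IndepFun z (fun ω i => a i ω) μ)
    {bad : (Fin m → A) → Set Z} (hbad : ∀ x, MeasurableSet (bad x)) {δ : ℝ}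
    (hδ : ∀ᵐ ω ∂μ, ∀ S : Finset (Fin m → A), (∀ x ∈ S, z ω ∈ bad x) →
      (S.card : ℝ) ≤ (Fintype.card A : ℝ) ^ m * δ) :
    μ.real {ω | z ω ∈ bad fun i => a i ω} ≤ δ := by
  classical
  have hN : (0 : ℝ) < Fintype.card A := by exact_mod_cast Fintype.card_pos
  -- The sample is uniform on its `N ^ m` values. Splitting over them and using independence makes
  -- the probability the mean proportion of bad samples for `z ω`.
  have hpt : ∀ x : Fin m → A,
      μ.real ((fun ω i => a i ω) ⁻¹' {x}) = ((Fintype.card A : ℝ) ^ m)⁻¹ := by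
    intro x
    have h1 : (fun ω i => a i ω) ⁻¹' {x} = ⋂ i ∈ Finset.univ, a i ⁻¹' {x i} := by
      ext ω; simp [funext_iff]
    have h2 : ∀ i, μ (a i ⁻¹' {x i}) = (Fintype.card A : ENNReal)⁻¹ := by
      intro i
      rw [← Measure.map_apply (ha i) (measurableSet_singleton _), hunif, uniformOn_univ]
      simp
    rw [h1, measureReal_def,
      hind.measure_inter_preimage_eq_mul Finset.univ (fun i _ => measurableSet_singleton _)]
    simp [h2]
  have hsub : {ω | z ω ∈ bad fun i => a i ω} ⊆
      ⋃ x : Fin m → A, z ⁻¹' bad x ∩ (fun ω i => a i ω) ⁻¹' {x} := fun ω hω =>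
    Set.mem_iUnion.2 ⟨fun i => a i ω, hω, rfl⟩
  have hterm : ∀ x : Fin m → A, μ.real (z ⁻¹' bad x ∩ (fun ω i => a i ω) ⁻¹' {x}) =
      ((Fintype.card A : ℝ) ^ m)⁻¹ * ∫ ω, (z ⁻¹' bad x).indicator 1 ω ∂μ := by
    intro x
    rw [integral_indicator_one (hz (hbad x)), measureReal_def,
      hza.measure_inter_preimage_eq_mul _ _ (hbad x) (measurableSet_singleton _),
      ENNReal.toReal_mul, ← measureReal_def, ← measureReal_def, hpt, mul_comm]
  have hint : ∀ x, Integrable ((z ⁻¹' bad x).indicator (1 : Ω → ℝ)) μ := fun x =>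
    (integrable_const (1 : ℝ)).indicator (hz (hbad x))
  calc μ.real {ω | z ω ∈ bad fun i => a i ω}
      ≤ ∑ x : Fin m → A, μ.real (z ⁻¹' bad x ∩ (fun ω i => a i ω) ⁻¹' {x}) :=
        (measureReal_mono hsub).trans (measureReal_iUnion_fintype_le _)
    _ = ((Fintype.card A : ℝ) ^ m)⁻¹ *
        ∫ ω, ∑ x, (z ⁻¹' bad x).indicator 1 ω ∂μ := by
        rw [integral_finsetSum _ fun x _ => hint x, Finset.mul_sum]
        exact Finset.sum_congr rfl fun x _ => hterm x
    _ ≤ ((Fintype.card A : ℝ) ^ m)⁻¹ * ∫ _, (Fintype.card A : ℝ) ^ m * δ ∂μ := by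
        refine mul_le_mul_of_nonneg_left (integral_mono_ae
          (integrable_finsetSum _ fun x _ => hint x) (integrable_const _) ?_) (by positivity)
        filter_upwards [hδ] with ω hω
        have := hω (Finset.univ.filter fun x => z ω ∈ bad x)
          (fun x hx => (Finset.mem_filter.1 hx).2)
        refine le_trans (le_of_eq ?_) this
        rw [← Finset.sum_boole]
        exact Finset.sum_congr rfl fun x _ => by simp [Set.indicator_apply]
    _ = δ := by simp

end Sampling

/-! ### The main theorem -/

theorem mainTheorem5 :
    ∃ C₁ : ℝ, 0 < C₁ ∧ ∃ C₂ : ℝ, 0 < C₂ ∧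
      ∀ (n₁ n₂ s m : ℕ), 0 < n₁ → 0 < n₂ → 0 < s → 0 < m →
      ∀ (Ω : Type*) [MeasurableSpace Ω] (μ : Measure Ω) [IsProbabilityMeasure μ]
        (a : Fin m → Ω → Fin s × Fin (sigLen n₁ n₂))
        (PT₁ PT₂ : Ω → Tensor3 n₁ n₂ s →L[ℂ] Tensor3 n₁ n₂ s),
        (∀ i, Measurable (a i)) →
        (∀ i, μ.map (a i) = uniformOn Set.univ) →
        iIndepFun a μ →
        Measurable PT₁ → Measurable PT₂ →
        (∀ ω, IsStarProjection (PT₁ ω)) → (∀ ω, IsStarProjection (PT₂ ω)) →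
        IndepFun (fun ω => (PT₁ ω, PT₂ ω)) (fun ω i => a i ω) μ →
        (∀ᵐ ω ∂μ, C₁ * (max (basisMax (PT₁ ω) ^ 2) (basisMax (PT₂ ω) ^ 2) *
            ((s : ℝ) * (sigLen n₁ n₂ : ℝ)) *
            Real.log ((s : ℝ) * (sigLen n₁ n₂ : ℝ))) ≤ (m : ℝ)) →
        1 - (((s : ℝ) * (sigLen n₁ n₂ : ℝ)) ^ 2)⁻¹ ≤
          μ.real {ω | ‖samplingDeviation (PT₁ ω) (PT₂ ω) (fun i => a i ω)‖ ≤
            C₂ * √(max (basisMax (PT₁ ω) ^ 2) (basisMax (PT₂ ω) ^ 2) *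
              ((s : ℝ) * (sigLen n₁ n₂ : ℝ)) *
              Real.log ((s : ℝ) * (sigLen n₁ n₂ : ℝ)) / (m : ℝ))} := by
  refine ⟨13, by norm_num, 28, by norm_num, ?_⟩
  intro n₁ n₂ s m h₁ h₂ hs hm Ω _ μ _ a PT₁ PT₂ ha hunif hind hm₁ hm₂ hP₁ hP₂ hindep hC
  have hn : 0 < sigLen n₁ n₂ := by simp only [sigLen]; omega
  have hcard : (Fintype.card (Fin s × Fin (sigLen n₁ n₂)) : ℝ) = (s : ℝ) * sigLen n₁ n₂ := by
    simp only [Fintype.card_prod, Fintype.card_fin]; push_cast; rfl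
  have hpos : 0 < s * sigLen n₁ n₂ := Nat.mul_pos hs hn
  -- If `sn = 1` the claimed lower bound is `0`; the counting bound needs `sn ≥ 2`.
  rcases Nat.lt_or_ge (s * sigLen n₁ n₂) 2 with hlt | hge
  · have h1 : (s : ℝ) * (sigLen n₁ n₂ : ℝ) = 1 := by
      exact_mod_cast (by omega : s * sigLen n₁ n₂ = 1)
    rw [h1, one_pow, inv_one, sub_self]
    exact measureReal_nonneg
  have : Nonempty (Fin s × Fin (sigLen n₁ n₂)) := ⟨(⟨0, hs⟩, ⟨0, hn⟩)⟩
  set R : (Tensor3 n₁ n₂ s →L[ℂ] Tensor3 n₁ n₂ s) ×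
      (Tensor3 n₁ n₂ s →L[ℂ] Tensor3 n₁ n₂ s) → ℝ := fun P =>
    28 * √(max (basisMax P.1 ^ 2) (basisMax P.2 ^ 2) * ((s : ℝ) * (sigLen n₁ n₂ : ℝ)) *
      Real.log ((s : ℝ) * (sigLen n₁ n₂ : ℝ)) / (m : ℝ)) with hR
  have hRm : Measurable R :=
    (((((((measurable_basisMax.comp measurable_fst).pow_const 2).max
      ((measurable_basisMax.comp measurable_snd).pow_const 2)).mul_const _).mul_const
      _).div_const _).sqrt).const_mul _
  have hbound := measureReal_bad_le_of_indepFun (z := fun ω => (PT₁ ω, PT₂ ω)) ha hunif hind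
    (hm₁.prodMk hm₂) hindep
    (bad := fun x => {P | R P < ‖samplingDeviation P.1 P.2 x‖})
    (fun x => measurableSet_lt hRm (measurable_samplingDeviation x))
    (δ := (((s : ℝ) * (sigLen n₁ n₂ : ℝ)) ^ 2)⁻¹) (by
      filter_upwards [hC] with ω hω S hS
      rw [← hcard]
      refine card_norm_empiricalDeviation_le (orthonormal_hankelFamily h₁ h₂)
        (by simpa using hge) hm (hP₁ ω) (hP₂ ω)
        (q := max (basisMax (PT₁ ω) ^ 2) (basisMax (PT₂ ω) ^ 2))
        (fun p => (norm_hankelTensorBasis_sq_le_basisMax _ p).trans (le_max_left _ _))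
        (fun p => (norm_hankelTensorBasis_sq_le_basisMax _ p).trans (le_max_right _ _))
        (by rw [hcard]; exact hω) S fun x hx => ?_
      rw [hcard, ← samplingDeviation_eq (hP₁ ω)]
      exact hS x hx)
  have hcompl : μ.real (Set.univ : Set Ω) ≤
      μ.real {ω | ‖samplingDeviation (PT₁ ω) (PT₂ ω) (fun i => a i ω)‖ ≤ R (PT₁ ω, PT₂ ω)} +
      μ.real {ω | (PT₁ ω, PT₂ ω) ∈
        {P : (Tensor3 n₁ n₂ s →L[ℂ] Tensor3 n₁ n₂ s) × (Tensor3 n₁ n₂ s →L[ℂ] Tensor3 n₁ n₂ s) |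
          R P < ‖samplingDeviation P.1 P.2 fun i => a i ω‖}} := by
    refine (measureReal_mono fun ω _ => ?_).trans (measureReal_union_le _ _)
    exact le_or_gt ‖samplingDeviation (PT₁ ω) (PT₂ ω) fun i => a i ω‖ (R (PT₁ ω, PT₂ ω))
  rw [probReal_univ] at hcompl
  linarith
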